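/- Let $\mathscr{H}$ be a finite-dimensional complex Hilbert space and let $T, S$ be linear operators on $\mathscr{H}$. Write $|T| = (T^*T)^{1/2}$, let $\|T\|_p = \big(\mathrm{tr}(|T|^p)\big)^{1/p}$ be the Schatten $p$-norm, and let $T = U|T|$ and $S = V|S|$ be the polar decompositions of $T$ and $S$ ($U$ and $V$ are partial isometries with $\ker U = \ker T$ and $\ker V = \ker S$). Operators $T$ and $S$ are called norm-parallel in the Schatten $p$-norm if $\|T + \lambda S\|_p = \|T\|_p + \|S\|_p$ for some $\lambda \in \mathbb{C}$ with $|\lambda| = 1$. If $1 < p < \infty$, then the following statements are equivalent: (i) $T$ is norm-parallel to $S$ in the Schatten $p$-norm. (ii) $\|T\|_p\,\big|\mathrm{tr}(|T|^{p-1}U^*S)\big| = \|S\|_p\,\mathrm{tr}(|T|^p)$. (iii) $\|S\|_p\,\big|\mathrm{tr}(|S|^{p-1}V^*T)\big| = \|T\|_p\,\mathrm{tr}(|S|^p)$. The same three statements are also equivalent for $p = 1$ if $T$ and $S$ are invertible (with $|T|^{0} = |S|^{0} = I$). -/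

import Mathlib

namespace SchattenParallel

/-- The trace of a bounded operator on a finite-dimensional complex Hilbert space. -/
noncomputable def opTrace {H : Type*} [NormedAddCommGroup H] [InnerProductSpace ℂ H]
    (A : H →L[ℂ] H) : ℂ :=
  LinearMap.trace ℂ H (A : H →ₗ[ℂ] H)

/-- The Schatten `p`-norm `(tr |T|^p)^(1/p)`, where `|T| = (T* T)^(1/2)` is `CFC.abs T` and the
power of the positive operator `|T|` is that of the continuous functional calculus. The trace of
`|T|^p` is a nonnegative real number, so taking its real part loses nothing. -/
noncomputable def schattenNorm {H : Type*} [NormedAddCommGroup H] [InnerProductSpace ℂ H]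
    [CompleteSpace H] (p : ℝ) (T : H →L[ℂ] H) : ℝ :=
  (opTrace (CFC.abs T ^ p)).re ^ (1 / p)

/-- `x` is norm-parallel to `y` with respect to the norm `N` on a complex vector space. -/
def NormParallel {V : Type*} [AddCommGroup V] [Module ℂ V] (N : V → ℝ) (x y : V) : Prop :=
  ∃ c : ℂ, ‖c‖ = 1 ∧ N (x + c • y) = N x + N y

/-- `T = U |T|` is the polar decomposition of `T`: `U` is the partial isometry (isometric on the
orthogonal complement of its kernel) with the same kernel as `T`. -/
structure IsPolarDecomposition {H : Type*} [NormedAddCommGroup H] [InnerProductSpace ℂ H]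
    [CompleteSpace H] (T U : H →L[ℂ] H) : Prop where
  eq_mul_abs : T = U * CFC.abs T
  isometry_on : ∀ x ∈ (LinearMap.ker (U : H →ₗ[ℂ] H))ᗮ, ‖U x‖ = ‖x‖
  ker_eq : LinearMap.ker (U : H →ₗ[ℂ] H) = LinearMap.ker (T : H →ₗ[ℂ] H)

end SchattenParallel

/-! Everything rests on the norming functional φ_T(X) = tr(|T|^(p-1) U* X). It satisfies φ_T(T) =
‖T‖^p and Hölder's bound |φ_T(X)| ≤ ‖T‖^(p-1) ‖X‖, and for T ≠ 0 statement (ii) says exactly that S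
attains this bound.

If it does, choose a unimodular c with c φ_T(S) = |φ_T(S)|; then φ_T(T + cS) = ‖T‖^(p-1) (‖T‖ +
‖S‖), so Hölder and Minkowski give norm-parallelism. Conversely, if R = T + cS has norm ‖T‖ + ‖S‖,
testing R against φ_R makes Hölder tight for both T and cS. For p > 1 tightness makes T a multiple
of R, hence S a multiple of T. For p = 1 and T invertible it forces R and T to have the same polar
factor, so φ_R = φ_T. Statement (iii) follows by symmetry.

Hölder is a rescaled Young inequality for traces. Expanded in eigenbases of |T| and |X|, the trace
is dominated by scalar Young terms with doubly substochastic weights (`overlap`). Equality there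
gives Re tr(T*X) = tr(T*T) = tr(X*X), so X = T. -/

namespace SchattenParallel

/-! ### Powers of positive operators on eigenvectors, and scalar Young inequalities -/

section Spectral

variable {H : Type*} [NormedAddCommGroup H] [InnerProductSpace ℂ H]

lemma finite_real_spectrum [FiniteDimensional ℂ H] (A : H →L[ℂ] H) : (spectrum ℝ A).Finite := by
  have h : (spectrum ℂ A).Finite := by
    have h1 := Module.End.finite_spectrum (A : H →ₗ[ℂ] H)
    rw [← AlgEquiv.spectrum_eq (Module.End.toContinuousLinearMap (𝕜 := ℂ) H)] at h1
    exact h1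
  exact h.preimage (f := algebraMap ℝ ℂ) (FaithfulSMul.algebraMap_injective ℝ ℂ).injOn

lemma aeval_apply_of_apply_eq_smul {A : H →L[ℂ] H} {e : H} {a : ℝ} (he : A e = (a : ℂ) • e)
    (q : Polynomial ℝ) : Polynomial.aeval A q e = ((q.eval a : ℝ) : ℂ) • e := by
  induction q using Polynomial.induction_on' with
  | add p q hp hq => simp [hp, hq, add_smul]
  | monomial n c =>
    have hn : (A ^ n) e = ((a ^ n : ℝ) : ℂ) • e := by
      induction n with
      | zero => simp
      | succ n ih =>
        rw [pow_succ', mul_apply_eq_comp, ih, map_smul, he, smul_smul]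
        push_cast; rw [pow_succ]
    simp [Polynomial.aeval_monomial, hn, Algebra.algebraMap_eq_smul_one, mul_smul]

/-- On a finite spectrum x ↦ x ^ s agrees with a polynomial, so continuity at 0 is no issue and
every real s is allowed. -/
lemma rpow_apply_of_apply_eq_smul [FiniteDimensional ℂ H] [CompleteSpace H]
    {A : H →L[ℂ] H} (hA : 0 ≤ A) {e : H} {a : ℝ}
    (he : A e = (a : ℂ) • e) (s : ℝ) : (A ^ s) e = ((a ^ s : ℝ) : ℂ) • e := by
  classical
  -- Adding `a` to the nodes avoids proving that it lies in the spectrum.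
  set N : Finset ℝ := insert a (finite_real_spectrum A).toFinset with hN
  set q := Lagrange.interpolate N id (fun x : ℝ => x ^ s) with hq
  have hqe : ∀ x ∈ N, q.eval x = x ^ s := fun x hx =>
    Lagrange.eval_interpolate_at_node (v := id) _ (Function.injective_id.injOn) hx
  have hsa : IsSelfAdjoint A := hA.isSelfAdjoint
  rw [CFC.rpow_eq_cfc_real hA, cfc_congr (g := q.eval), cfc_polynomial q A,
    aeval_apply_of_apply_eq_smul he, hqe a (by simp [hN])]
  intro x hx
  exact (hqe x (by simp [hN, hx])).symm

lemma exists_eigenbasis [FiniteDimensional ℂ H] {A : H →L[ℂ] H} (hA : 0 ≤ A) :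
    ∃ (e : OrthonormalBasis (Fin (Module.finrank ℂ H)) ℂ H) (a : Fin (Module.finrank ℂ H) → ℝ),
      (∀ i, 0 ≤ a i) ∧ ∀ i, A (e i) = (a i : ℂ) • e i := by
  rw [ContinuousLinearMap.nonneg_iff_isPositive] at hA
  have hs : (A : H →ₗ[ℂ] H).IsSymmetric := hA.isSymmetric
  refine ⟨hs.eigenvectorBasis rfl, hs.eigenvalues rfl, fun i => ?_, fun i => ?_⟩
  · have h1 := hA.re_inner_nonneg_left (hs.eigenvectorBasis rfl i)
    have h2 := hs.apply_eigenvectorBasis rfl i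
    simp only [ContinuousLinearMap.coe_coe] at h2
    rw [h2, inner_smul_left] at h1
    simpa using h1
  · exact hs.apply_eigenvectorBasis rfl i

lemma opTrace_eq_sum {ι : Type*} [Fintype ι] (e : OrthonormalBasis ι ℂ H) (A : H →L[ℂ] H) :
    opTrace A = ∑ i, inner ℂ (e i) (A (e i)) :=
  LinearMap.trace_eq_sum_inner _ e

lemma opTrace_rpow_eq_sum [FiniteDimensional ℂ H] [CompleteSpace H]
    {ι : Type*} [Fintype ι] (e : OrthonormalBasis ι ℂ H) {a : ι → ℝ}
    {A : H →L[ℂ] H} (hA : 0 ≤ A) (h : ∀ i, A (e i) = (a i : ℂ) • e i) (s : ℝ) :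
    opTrace (A ^ s) = ((∑ i, a i ^ s : ℝ) : ℂ) := by
  rw [opTrace_eq_sum e]
  push_cast
  refine Finset.sum_congr rfl fun i _ => ?_
  rw [rpow_apply_of_apply_eq_smul hA (h i), inner_smul_right]
  simp

lemma rpow_sub_one_mul_self [FiniteDimensional ℂ H] [CompleteSpace H]
    {A : H →L[ℂ] H} (hA : 0 ≤ A) {p : ℝ} (hp : 1 ≤ p) :
    A ^ (p - 1) * A = A ^ p := by
  obtain ⟨e, a, ha, h⟩ := exists_eigenbasis hA
  apply ContinuousLinearMap.coe_injective
  refine e.toBasis.ext fun i => ?_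
  simp only [OrthonormalBasis.coe_toBasis, ContinuousLinearMap.coe_coe,
    mul_apply_eq_comp]
  rw [h, map_smul, rpow_apply_of_apply_eq_smul hA (h i), rpow_apply_of_apply_eq_smul hA (h i),
    smul_smul, ← Complex.ofReal_mul]
  congr 2
  rcases (ha i).eq_or_lt with h0 | h0
  · rw [← h0, zero_mul, Real.zero_rpow (zero_lt_one.trans_le hp).ne']
  · rw [Real.rpow_sub_one h0.ne', mul_div_cancel₀ _ h0.ne']

lemma rpow_sub_one_mul_le {p : ℝ} (hp : 1 ≤ p) {r t : ℝ} (hr : 0 ≤ r) (ht : 0 ≤ t) :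
    r ^ (p - 1) * t ≤ (1 - 1 / p) * r ^ p + 1 / p * t ^ p := by
  have hp0 : 0 < p := by linarith
  rcases hp.eq_or_lt with rfl | hp1
  · simp
  have := Real.geom_mean_le_arith_mean2_weighted (w₁ := 1 - 1 / p) (w₂ := 1 / p)
    (p₁ := r ^ p) (p₂ := t ^ p)
    (by rw [sub_nonneg, div_le_one hp0]; exact hp) (by positivity) (by positivity) (by positivity)
    (by ring)
  rwa [← Real.rpow_mul hr, ← Real.rpow_mul ht, mul_one_div_cancel hp0.ne', Real.rpow_one,
    show p * (1 - 1 / p) = p - 1 by field_simp] at this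

lemma rpow_sub_one_mul_lt {p : ℝ} (hp : 1 < p) {r t : ℝ} (hr : 0 ≤ r) (ht : 0 ≤ t)
    (hrt : r ≠ t) : r ^ (p - 1) * t < (1 - 1 / p) * r ^ p + 1 / p * t ^ p := by
  have hp0 : 0 < p := by linarith
  rcases hr.eq_or_lt with rfl | hr0
  · rw [Real.zero_rpow (by linarith), Real.zero_rpow hp0.ne']
    have : 0 < t := lt_of_le_of_ne ht hrt
    simp only [zero_mul, mul_zero, zero_add]
    positivity
  have hs : t / r - 1 ≠ 0 := fun h => hrt (by field_simp at h; linarith)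
  -- Strict Bernoulli at t / r, to be multiplied by r ^ p / p.
  have hb := one_add_mul_self_lt_rpow_one_add (s := t / r - 1)
    (by have : 0 ≤ t / r := by positivity
        linarith) hs hp
  rw [add_sub_cancel, Real.div_rpow ht hr] at hb
  have hrp : 0 < r ^ p := by positivity
  have he : r ^ (p - 1) * t = r ^ p * (t / r) := by
    rw [Real.rpow_sub_one hr0.ne']; field_simp
  have h2 : r ^ p * (1 + p * (t / r - 1)) < t ^ p := by
    rwa [lt_div_iff₀ hrp, mul_comm] at hb
  rw [he]
  have h3 : 1 / p * (r ^ p * (1 + p * (t / r - 1))) < 1 / p * t ^ p :=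
    mul_lt_mul_of_pos_left h2 (by positivity)
  have h4 : 1 / p * (r ^ p * (1 + p * (t / r - 1))) =
      r ^ p * (t / r) - (1 - 1 / p) * r ^ p := by field_simp; ring
  linarith

end Spectral

/-! ### Young's inequality for traces and its equality case -/

section Young

/-- Split the sum: the terms in `r` use the row sums, those in `t` the column sums. -/
lemma sum_young_mul_weight_le {ι κ : Type*} [Fintype ι] [Fintype κ] {p : ℝ} (hp : 1 ≤ p)
    {r : ι → ℝ} {t : κ → ℝ} {w : ι → κ → ℝ} (hr : ∀ i, 0 ≤ r i) (ht : ∀ j, 0 ≤ t j)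
    (hrow : ∀ i, ∑ j, w i j ≤ 1) (hcol : ∀ j, ∑ i, w i j ≤ 1) :
    ∑ i, ∑ j, ((1 - 1 / p) * r i ^ p + 1 / p * t j ^ p) * w i j ≤
      (1 - 1 / p) * ∑ i, r i ^ p + 1 / p * ∑ j, t j ^ p := by
  have hp0 : 0 < p := by linarith
  have hq : 0 ≤ 1 - 1 / p := by rw [sub_nonneg, div_le_one hp0]; exact hp
  have h1 : ∑ i, ∑ j, (1 - 1 / p) * r i ^ p * w i j ≤ ∑ i, (1 - 1 / p) * r i ^ p := by
    refine Finset.sum_le_sum fun i _ => ?_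
    rw [← Finset.mul_sum]
    exact mul_le_of_le_one_right (mul_nonneg hq (Real.rpow_nonneg (hr i) _)) (hrow i)
  have h2 : ∑ j, ∑ i, 1 / p * t j ^ p * w i j ≤ ∑ j, 1 / p * t j ^ p := by
    refine Finset.sum_le_sum fun j _ => ?_
    rw [← Finset.mul_sum]
    exact mul_le_of_le_one_right (mul_nonneg (by positivity) (Real.rpow_nonneg (ht j) _)) (hcol j)
  rw [Finset.sum_comm] at h2
  simp only [add_mul, Finset.sum_add_distrib, Finset.mul_sum]
  exact add_le_add h1 h2

lemma rpow_sub_one_mul_mul_le {p : ℝ} (hp : 1 ≤ p) {r t w m : ℝ} (hr : 0 ≤ r) (ht : 0 ≤ t)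
    (hw : 0 ≤ w) (hm : m ≤ w) :
    r ^ (p - 1) * t * m ≤ ((1 - 1 / p) * r ^ p + 1 / p * t ^ p) * w :=
  (mul_le_mul_of_nonneg_left hm (mul_nonneg (Real.rpow_nonneg hr _) ht)).trans
    (mul_le_mul_of_nonneg_right (rpow_sub_one_mul_le hp hr ht) hw)

lemma eq_of_rpow_sub_one_mul_mul_eq {p : ℝ} (hp : 1 < p) {r t w m : ℝ} (hr : 0 ≤ r)
    (ht : 0 ≤ t) (hw : 0 ≤ w) (hm : m ≤ w)
    (h : r ^ (p - 1) * t * m = ((1 - 1 / p) * r ^ p + 1 / p * t ^ p) * w) :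
    w = 0 ∨ (r = t ∧ (r = 0 ∨ m = w)) := by
  have hrt : 0 ≤ r ^ (p - 1) * t := mul_nonneg (Real.rpow_nonneg hr _) ht
  have h1 : r ^ (p - 1) * t * m ≤ r ^ (p - 1) * t * w := mul_le_mul_of_nonneg_left hm hrt
  rcases hw.eq_or_lt with h0 | h0
  · exact Or.inl h0.symm
  right
  have heq : r = t := by
    by_contra hne
    have := mul_lt_mul_of_pos_right (rpow_sub_one_mul_lt hp hr ht hne) h0
    linarith
  refine ⟨heq, ?_⟩
  rcases hr.eq_or_lt with hr0 | hr0
  · exact Or.inl hr0.symm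
  right
  subst heq
  have h2 := mul_le_mul_of_nonneg_right (rpow_sub_one_mul_le hp.le hr ht) hw
  have hpos : 0 < r ^ (p - 1) * r := by positivity
  exact mul_left_cancel₀ hpos.ne' (by linarith)

variable {H : Type*} [NormedAddCommGroup H] [InnerProductSpace ℂ H]

/-- Half the sum of the squared moduli of the matrix coefficients of `1` and `C`. -/
noncomputable def overlap {ι κ : Type*} [Fintype ι] [Fintype κ] (e : OrthonormalBasis ι ℂ H)
    (f : OrthonormalBasis κ ℂ H) (C : H →L[ℂ] H) (i : ι) (j : κ) : ℝ :=
  (‖inner ℂ (e i) (f j)‖ ^ 2 + ‖inner ℂ (e i) (C (f j))‖ ^ 2) / 2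

variable {ι κ : Type*} [Fintype ι] [Fintype κ] (e : OrthonormalBasis ι ℂ H)
    (f : OrthonormalBasis κ ℂ H)

lemma overlap_nonneg (C : H →L[ℂ] H) (i : ι) (j : κ) : 0 ≤ overlap e f C i j := by
  unfold overlap; positivity

lemma norm_mul_le_overlap (C : H →L[ℂ] H) (i : ι) (j : κ) :
    ‖inner ℂ (f j) (e i) * inner ℂ (e i) (C (f j))‖ ≤ overlap e f C i j := by
  rw [norm_mul, overlap, norm_inner_symm (f j)]
  nlinarith [sq_nonneg (‖inner ℂ (e i) (f j)‖ - ‖inner ℂ (e i) (C (f j))‖)]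

/-- With z = ⟨e i, f j⟩ and w = ⟨e i, C (f j)⟩, the hypothesis says |z - w|² = 0. -/
lemma eq_of_re_mul_eq_overlap {C : H →L[ℂ] H} {i : ι} {j : κ}
    (h : (inner ℂ (f j) (e i) * inner ℂ (e i) (C (f j))).re = overlap e f C i j) :
    inner ℂ (e i) (C (f j)) = inner ℂ (e i) (f j) := by
  rw [overlap, ← inner_conj_symm, ← Complex.normSq_eq_norm_sq, ← Complex.normSq_eq_norm_sq] at h
  simp only [Complex.mul_re, Complex.conj_re, Complex.conj_im, Complex.normSq_apply] at h
  apply Complex.ext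
  · nlinarith [sq_nonneg ((inner ℂ (e i) (f j) : ℂ).re - (inner ℂ (e i) (C (f j)) : ℂ).re),
      sq_nonneg ((inner ℂ (e i) (f j) : ℂ).im - (inner ℂ (e i) (C (f j)) : ℂ).im)]
  · nlinarith [sq_nonneg ((inner ℂ (e i) (f j) : ℂ).re - (inner ℂ (e i) (C (f j)) : ℂ).re),
      sq_nonneg ((inner ℂ (e i) (f j) : ℂ).im - (inner ℂ (e i) (C (f j)) : ℂ).im)]

/-- By Parseval the sum is the mean of ‖f j‖² = 1 and ‖C (f j)‖² ≤ 1. -/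
lemma sum_overlap_left_le {C : H →L[ℂ] H} (hC : ‖C‖ ≤ 1) (j : κ) :
    ∑ i, overlap e f C i j ≤ 1 := by
  have h1 := e.sum_sq_norm_inner_right (f j)
  have h2 := e.sum_sq_norm_inner_right (C (f j))
  have h3 : ‖C (f j)‖ ≤ 1 := by simpa using C.le_of_opNorm_le hC (f j)
  simp only [overlap, ← Finset.sum_div, Finset.sum_add_distrib, h1, h2]
  simp only [OrthonormalBasis.norm_eq_one]
  nlinarith [norm_nonneg (C (f j))]

/-- A contraction attaining the trace norm of an invertible positive operator is the identity. -/
lemma eq_one_of_re_opTrace_mul_eq [FiniteDimensional ℂ H] {B C : H →L[ℂ] H} (hB : 0 ≤ B) (hBu : IsUnit B)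
    (hC : ‖C‖ ≤ 1) (h : (opTrace (C * B)).re = (opTrace B).re) : C = 1 := by
  obtain ⟨f, t, ht, hf⟩ := exists_eigenbasis hB
  have ht0 : ∀ j, 0 < t j := by
    intro j
    refine lt_of_le_of_ne (ht j) fun h0 => ?_
    obtain ⟨D, hD⟩ := hBu.exists_left_inv
    have h1 : D (B (f j)) = f j := by rw [← mul_apply_eq_comp, hD, one_apply_eq_self]
    rw [hf, ← h0, Complex.ofReal_zero, zero_smul, map_zero] at h1
    exact f.orthonormal.ne_zero j h1.symm
  rw [opTrace_eq_sum f, opTrace_eq_sum f, Complex.re_sum, Complex.re_sum] at h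
  have hn : ∀ j, ‖C (f j)‖ ≤ 1 := fun j => by simpa using C.le_of_opNorm_le hC (f j)
  have hre : ∀ j, (inner ℂ (f j) (C (f j)) : ℂ).re ≤ 1 := fun j =>
    (Complex.re_le_norm _).trans ((norm_inner_le_norm _ _).trans (by simpa using hn j))
  have hl : ∀ j, (inner ℂ (f j) ((C * B) (f j)) : ℂ).re =
      t j * (inner ℂ (f j) (C (f j)) : ℂ).re := fun j => by
    rw [mul_apply_eq_comp, hf, map_smul, inner_smul_right, Complex.re_ofReal_mul]
  have hrr : ∀ j, (inner ℂ (f j) (B (f j)) : ℂ).re = t j := fun j => by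
    rw [hf, inner_smul_right, Complex.re_ofReal_mul]; simp
  simp only [hl, hrr] at h
  rw [Finset.sum_eq_sum_iff_of_le fun j _ => mul_le_of_le_one_right (ht j) (hre j)] at h
  apply ContinuousLinearMap.coe_injective
  refine f.toBasis.ext fun j => ?_
  simp only [OrthonormalBasis.coe_toBasis, ContinuousLinearMap.coe_coe, one_apply_eq_self]
  have h1 : (inner ℂ (f j) (C (f j)) : ℂ).re = 1 :=
    mul_left_cancel₀ (ht0 j).ne' ((h j (Finset.mem_univ j)).trans (mul_one _).symm)
  have h2 := norm_sub_sq (𝕜 := ℂ) (f j) (C (f j))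
  rw [RCLike.re_eq_complex_re, h1] at h2
  simp only [OrthonormalBasis.norm_eq_one] at h2
  -- The expansion is 1 - 2 + ‖C (f j)‖².
  have h3 : ‖f j - C (f j)‖ ^ 2 ≤ 0 := by nlinarith [hn j, norm_nonneg (C (f j))]
  have h4 : f j - C (f j) = 0 :=
    norm_eq_zero.1 (pow_eq_zero_iff two_ne_zero |>.1 (le_antisymm h3 (sq_nonneg _)))
  exact (sub_eq_zero.1 h4).symm

variable [CompleteSpace H]

lemma sum_overlap_right_le {C : H →L[ℂ] H} (hC : ‖C‖ ≤ 1) (i : ι) :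
    ∑ j, overlap e f C i j ≤ 1 := by
  have h1 := f.sum_sq_norm_inner_left (e i)
  have h2 := f.sum_sq_norm_inner_left (star C (e i))
  have hC' : ‖star C‖ ≤ 1 := by rwa [norm_star]
  have h3 : ‖star C (e i)‖ ≤ 1 := by simpa using (star C).le_of_opNorm_le hC' (e i)
  simp only [ContinuousLinearMap.star_eq_adjoint, ContinuousLinearMap.adjoint_inner_left] at h2 h3
  simp only [overlap, ← Finset.sum_div, Finset.sum_add_distrib, h1, h2]
  simp only [OrthonormalBasis.norm_eq_one]
  nlinarith [norm_nonneg (ContinuousLinearMap.adjoint C (e i))]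

variable [FiniteDimensional ℂ H]

lemma opTrace_rpow_mul_mul {A B : H →L[ℂ] H} (hA : 0 ≤ A) {r : ι → ℝ} {t : κ → ℝ}
    (he : ∀ i, A (e i) = (r i : ℂ) • e i) (hf : ∀ j, B (f j) = (t j : ℂ) • f j)
    (C : H →L[ℂ] H) (s : ℝ) :
    opTrace (A ^ s * C * B) = ∑ i, ∑ j, ((r i ^ s * t j : ℝ) : ℂ) *
      (inner ℂ (f j) (e i) * inner ℂ (e i) (C (f j))) := by
  rw [opTrace_eq_sum f, Finset.sum_comm]
  refine Finset.sum_congr rfl fun j _ => ?_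
  rw [← e.sum_inner_mul_inner]
  refine Finset.sum_congr rfl fun i _ => ?_
  have hs : IsSelfAdjoint (A ^ s) := (CFC.rpow_nonneg (a := A) (y := s)).isSelfAdjoint
  have h1 : inner ℂ (e i) ((A ^ s) (C (f j))) = inner ℂ ((A ^ s) (e i)) (C (f j)) := by
    rw [← ContinuousLinearMap.adjoint_inner_left, hs.adjoint_eq]
  rw [mul_apply_eq_comp, mul_apply_eq_comp, hf, map_smul, map_smul, inner_smul_right, h1,
    rpow_apply_of_apply_eq_smul hA (he i), inner_smul_left, Complex.conj_ofReal]
  push_cast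
  ring

lemma re_opTrace_rpow_mul_mul {A B : H →L[ℂ] H} (hA : 0 ≤ A) {r : ι → ℝ} {t : κ → ℝ}
    (he : ∀ i, A (e i) = (r i : ℂ) • e i) (hf : ∀ j, B (f j) = (t j : ℂ) • f j)
    (C : H →L[ℂ] H) (s : ℝ) :
    (opTrace (A ^ s * C * B)).re = ∑ i, ∑ j, r i ^ s * t j *
      (inner ℂ (f j) (e i) * inner ℂ (e i) (C (f j))).re := by
  simp only [opTrace_rpow_mul_mul e f hA he hf, Complex.re_sum, Complex.re_ofReal_mul]

/-- Young's inequality for the trace of a product. -/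
lemma re_opTrace_rpow_sub_one_mul_mul_le {p : ℝ} (hp : 1 ≤ p) {A B C : H →L[ℂ] H} (hA : 0 ≤ A)
    (hB : 0 ≤ B) (hC : ‖C‖ ≤ 1) :
    (opTrace (A ^ (p - 1) * C * B)).re ≤
      (1 - 1 / p) * (opTrace (A ^ p)).re + 1 / p * (opTrace (B ^ p)).re := by
  obtain ⟨e, r, hr, he⟩ := exists_eigenbasis hA
  obtain ⟨f, t, ht, hf⟩ := exists_eigenbasis hB
  rw [opTrace_rpow_eq_sum e hA he, opTrace_rpow_eq_sum f hB hf,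
    re_opTrace_rpow_mul_mul e f hA he hf, Complex.ofReal_re, Complex.ofReal_re]
  refine le_trans ?_ (sum_young_mul_weight_le hp hr ht (sum_overlap_right_le e f hC)
    (sum_overlap_left_le e f hC))
  exact Finset.sum_le_sum fun i _ => Finset.sum_le_sum fun j _ =>
    rpow_sub_one_mul_mul_le hp (hr i) (ht j) (overlap_nonneg e f C i j)
      ((Complex.re_le_norm _).trans (norm_mul_le_overlap e f C i j))

/-- The equality case of Young's inequality for the trace of a product. -/
lemma re_opTrace_mul_mul_of_young_eq {p : ℝ} (hp : 1 < p) {A B C : H →L[ℂ] H} (hA : 0 ≤ A)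
    (hB : 0 ≤ B) (hC : ‖C‖ ≤ 1)
    (h : (opTrace (A ^ (p - 1) * C * B)).re =
      (1 - 1 / p) * (opTrace (A ^ p)).re + 1 / p * (opTrace (B ^ p)).re) :
    (opTrace (A * C * B)).re = (opTrace (A ^ (2 : ℝ))).re ∧
      (opTrace (A * C * B)).re = (opTrace (B ^ (2 : ℝ))).re := by
  obtain ⟨e, r, hr, he⟩ := exists_eigenbasis hA
  obtain ⟨f, t, ht, hf⟩ := exists_eigenbasis hB
  rw [opTrace_rpow_eq_sum e hA he, opTrace_rpow_eq_sum f hB hf,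
    re_opTrace_rpow_mul_mul e f hA he hf, Complex.ofReal_re, Complex.ofReal_re] at h
  have hm := fun i j => (Complex.re_le_norm _).trans (norm_mul_le_overlap e f C i j)
  have hle := fun i j => rpow_sub_one_mul_mul_le hp.le (hr i) (ht j) (overlap_nonneg e f C i j)
    (hm i j)
  -- The hypothesis closes the chain of inequalities, so equality holds for every pair (i, j).
  have hsum := le_antisymm
    (Finset.sum_le_sum fun i (_ : i ∈ Finset.univ) =>
      Finset.sum_le_sum fun j (_ : j ∈ Finset.univ) => hle i j)
    (h ▸ sum_young_mul_weight_le hp.le hr ht (sum_overlap_right_le e f hC)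
      (sum_overlap_left_le e f hC))
  rw [Finset.sum_eq_sum_iff_of_le fun i _ => Finset.sum_le_sum fun j _ => hle i j] at hsum
  have hij : ∀ i j, _ := fun i j => (Finset.sum_eq_sum_iff_of_le fun j _ => hle i j).1
    (hsum i (Finset.mem_univ i)) j (Finset.mem_univ j)
  -- Termwise equality no longer depends on p: squares replace p-th powers, and Parseval then sums
  -- them to the traces of A² and B².
  have key : ∀ i j, r i * t j * (inner ℂ (f j) (e i) * inner ℂ (e i) (C (f j))).re =
        r i ^ 2 * ‖inner ℂ (e i) (f j)‖ ^ 2 ∧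
      r i ^ 2 * ‖inner ℂ (e i) (f j)‖ ^ 2 = t j ^ 2 * ‖inner ℂ (e i) (f j)‖ ^ 2 := by
    intro i j
    rcases eq_of_rpow_sub_one_mul_mul_eq hp (hr i) (ht j) (overlap_nonneg e f C i j) (hm i j)
      (hij i j) with h0 | ⟨h1, h2⟩
    · have hz : ‖inner ℂ (e i) (f j)‖ ^ 2 = 0 := by
        unfold overlap at h0
        have := sq_nonneg ‖inner ℂ (e i) (f j)‖
        have := sq_nonneg ‖inner ℂ (e i) (C (f j))‖
        linarith
      have hz' : inner ℂ (f j) (e i) = 0 := by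
        rw [← norm_eq_zero, norm_inner_symm]; exact pow_eq_zero_iff two_ne_zero |>.1 hz
      simp [hz, hz']
    · rw [← h1]
      refine ⟨?_, rfl⟩
      rcases h2 with h2 | h2
      · simp [h2]
      · rw [eq_of_re_mul_eq_overlap e f h2, ← inner_conj_symm, ← Complex.normSq_eq_conj_mul_self,
          Complex.ofReal_re, Complex.normSq_eq_norm_sq]
        ring
  have hA1 : A * C * B = A ^ (1 : ℝ) * C * B := by rw [CFC.rpow_one A]
  rw [hA1, re_opTrace_rpow_mul_mul e f hA he hf, opTrace_rpow_eq_sum e hA he,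
    opTrace_rpow_eq_sum f hB hf, Complex.ofReal_re, Complex.ofReal_re]
  simp only [Real.rpow_one, Real.rpow_two]
  constructor
  · refine Finset.sum_congr rfl fun i _ => ?_
    rw [Finset.sum_congr rfl fun j _ => (key i j).1, ← Finset.mul_sum, f.sum_sq_norm_inner_left]
    simp
  · rw [Finset.sum_comm]
    refine Finset.sum_congr rfl fun j _ => ?_
    rw [Finset.sum_congr rfl fun i _ => (key i j).1.trans (key i j).2, ← Finset.mul_sum,
      e.sum_sq_norm_inner_right]
    simp

end Young

/-! ### Polar factors -/

section PolarFactor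

variable {H : Type*} [NormedAddCommGroup H] [InnerProductSpace ℂ H] [CompleteSpace H]

/-- `U` is a contraction which mediates between `T` and `|T|`. -/
structure IsPolarFactor (T U : H →L[ℂ] H) : Prop where
  norm_le : ‖U‖ ≤ 1
  eq_mul_abs : T = U * CFC.abs T
  star_mul_eq : star U * T = CFC.abs T

lemma norm_apply_abs (T : H →L[ℂ] H) (x : H) : ‖CFC.abs T x‖ = ‖T x‖ := by
  have h : star (CFC.abs T) * CFC.abs T = star T * T := by
    rw [(CFC.abs_nonneg T).isSelfAdjoint.star_eq, CFC.abs_mul_abs]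
  have h1 := ContinuousLinearMap.apply_norm_sq_eq_inner_adjoint_left (CFC.abs T) x
  have h2 := ContinuousLinearMap.apply_norm_sq_eq_inner_adjoint_left T x
  rw [← ContinuousLinearMap.star_eq_adjoint] at h1 h2
  change _ = RCLike.re (inner ℂ ((star (CFC.abs T) * CFC.abs T) x) x) at h1
  rw [h] at h1
  exact (sq_eq_sq₀ (norm_nonneg _) (norm_nonneg _)).1 (h1.trans h2.symm)

lemma IsPolarDecomposition.isPolarFactor {T U : H →L[ℂ] H} (h : IsPolarDecomposition T U) :
    IsPolarFactor T U := by
  set K : Submodule ℂ H := LinearMap.ker (U : H →ₗ[ℂ] H) with hK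
  have hKc : IsClosed (K : Set H) := ContinuousLinearMap.isClosed_ker U
  have : CompleteSpace K := hKc.completeSpace_coe
  have hU : ‖U‖ ≤ 1 := by
    refine U.opNorm_le_bound zero_le_one fun x => ?_
    have h1 : U (K.starProjection x) = 0 := K.starProjection_apply_mem x
    have h2 := h.isometry_on _ (K.sub_starProjection_mem_orthogonal x)
    rw [map_sub, h1, sub_zero] at h2
    rw [h2, one_mul]
    have h3 := Kᗮ.norm_starProjection_apply_le x
    rwa [Submodule.starProjection_orthogonal'] at h3
  refine ⟨hU, h.eq_mul_abs, ?_⟩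
  nth_rewrite 1 [h.eq_mul_abs]
  ext x
  set y := CFC.abs T x with hy
  -- The range of |T| is orthogonal to ker |T| = ker T = ker U.
  have hyK : y ∈ Kᗮ := by
    rw [Submodule.mem_orthogonal]
    intro k hk
    rw [hK, h.ker_eq] at hk
    have hk0 : CFC.abs T k = 0 := by
      rw [← norm_eq_zero, norm_apply_abs, norm_eq_zero]; exact hk
    have hs : IsSelfAdjoint (CFC.abs T) := (CFC.abs_nonneg T).isSelfAdjoint
    rw [hy, ← ContinuousLinearMap.adjoint_inner_left, hs.adjoint_eq, hk0, inner_zero_left]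
  have hUy := h.isometry_on y hyK
  change star U (U y) = y
  have h4 := norm_sub_sq (𝕜 := ℂ) (star U (U y)) y
  rw [ContinuousLinearMap.star_eq_adjoint, ContinuousLinearMap.adjoint_inner_left,
    inner_self_eq_norm_sq, hUy, ← ContinuousLinearMap.star_eq_adjoint] at h4
  have h5 : ‖star U (U y)‖ ≤ ‖y‖ := by
    have := (star U).le_of_opNorm_le ((norm_star U).trans_le hU) (U y)
    rwa [one_mul, hUy] at this
  -- The expansion is ‖U*Uy‖² - 2‖Uy‖² + ‖y‖² with ‖Uy‖ = ‖y‖.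
  have h6 : ‖star U (U y) - y‖ ^ 2 ≤ 0 := by nlinarith [norm_nonneg (star U (U y))]
  exact sub_eq_zero.1
    (norm_eq_zero.1 (pow_eq_zero_iff two_ne_zero |>.1 (le_antisymm h6 (sq_nonneg _))))

/-- Invertibility of |T| makes U an isometry, hence unitary in finite dimension, so its left inverse
is unique. -/
lemma IsPolarFactor.star_eq_of_mul_eq_one [FiniteDimensional ℂ H] {T U W : H →L[ℂ] H}
    (hU : IsPolarFactor T U) (hT : IsUnit (CFC.abs T)) (h : star W * U = 1) :
    star W = star U := by
  have h1 : star U * U = 1 := by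
    have h2 := hU.star_mul_eq
    nth_rewrite 1 [hU.eq_mul_abs] at h2
    rw [← mul_assoc] at h2
    exact hT.mul_right_cancel (by rw [h2, one_mul])
  have h3 : U * star U = 1 := by
    have h4 : (star U : H →L[ℂ] H).toLinearMap * U.toLinearMap = 1 :=
      congrArg ContinuousLinearMap.toLinearMap h1
    have h5 := mul_eq_one_comm.1 h4
    exact ContinuousLinearMap.coe_injective h5
  calc star W = star W * (U * star U) := by rw [h3, mul_one]
    _ = star U := by rw [← mul_assoc, h, one_mul]

lemma isUnit_abs {T : H →L[ℂ] H} (hT : IsUnit T) : IsUnit (CFC.abs T) := by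
  have h : IsUnit (CFC.abs T ^ 2) := by rw [CFC.abs_sq]; exact hT.star.mul hT
  exact (isUnit_pow_iff two_ne_zero).1 h

variable [FiniteDimensional ℂ H]

/-- Supplies a factor for auxiliary operators such as T + cS, which come with no given polar
decomposition. -/
lemma exists_isPolarFactor (T : H →L[ℂ] H) : ∃ W, IsPolarFactor T W := by
  set A := CFC.abs T with hAdef
  have hA : 0 ≤ A := CFC.abs_nonneg T
  -- Since 0 ^ (-1) = 0 in `ℝ`, this is the Moore–Penrose inverse of A, even when A is singular.
  set D := A ^ (-1 : ℝ) with hD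
  have hAs : star A = A := hA.isSelfAdjoint.star_eq
  have hDs : star D = D := (CFC.rpow_nonneg (a := A) (y := -1)).isSelfAdjoint.star_eq
  obtain ⟨e, a, ha, h⟩ := exists_eigenbasis hA
  have hd : ∀ i, D (e i) = (((a i)⁻¹ : ℝ) : ℂ) • e i := fun i => by
    rw [hD, rpow_apply_of_apply_eq_smul hA (h i), Real.rpow_neg_one]
  have hext : ∀ {X Y : H →L[ℂ] H}, (∀ i, X (e i) = Y (e i)) → X = Y := fun hXY =>
    ContinuousLinearMap.coe_injective (e.toBasis.ext fun i => by simpa using hXY i)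
  have hcomm : D * A = A * D := hext fun i => by
    simp only [mul_apply_eq_comp, h, hd, map_smul]; rw [smul_comm]
  have hADA : A * (D * A) = A := hext fun i => by
    simp only [mul_apply_eq_comp, h, hd, map_smul, smul_smul, ← Complex.ofReal_mul]
    congr 2
    rcases eq_or_ne (a i) 0 with h0 | h0
    · simp [h0]
    · field_simp
  have hTT : star T * T = A * A := (CFC.abs_mul_abs T).symm
  refine ⟨T * D, ?_, ?_, ?_⟩
  · have hP : IsStarProjection (A * D) := by
      refine ⟨?_, ?_⟩
      · rw [IsIdempotentElem, ← mul_assoc, mul_assoc A D A, hADA]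
      · rw [IsSelfAdjoint, star_mul, hAs, hDs, hcomm]
    have h1 : star (T * D) * (T * D) = A * D := by
      calc star (T * D) * (T * D) = D * (star T * T) * D := by
            rw [star_mul, hDs]; simp only [mul_assoc]
        _ = D * A * (A * D) := by rw [hTT]; simp only [mul_assoc]
        _ = A * D := by rw [hcomm]; exact hP.isIdempotentElem
    have h2 : ‖T * D‖ * ‖T * D‖ ≤ 1 := by
      rw [← CStarRing.norm_star_mul_self, h1]; exact hP.norm_le
    nlinarith [norm_nonneg (T * D)]
  · have h1 : T * (1 - D * A) = 0 := by
      rw [← CStarRing.star_mul_self_eq_zero_iff]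
      calc star (T * (1 - D * A)) * (T * (1 - D * A))
          = star (1 - D * A) * (star T * T) * (1 - D * A) := by
            rw [star_mul]; simp only [mul_assoc]
        _ = star (1 - D * A) * A * (A * (1 - D * A)) := by rw [hTT]; simp only [mul_assoc]
        _ = 0 := by rw [mul_sub A, hADA, mul_one, sub_self, mul_zero]
    rw [mul_sub, mul_one, sub_eq_zero] at h1
    rw [mul_assoc, ← h1]
  · rw [star_mul, hDs, mul_assoc, hTT, ← mul_assoc, hcomm, mul_assoc, hADA]

end PolarFactor

/-! ### The norming functional: Hölder, Minkowski and norm-parallelism -/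

section Pairing

section Trace

variable {H : Type*} [NormedAddCommGroup H] [InnerProductSpace ℂ H]

lemma opTrace_add (A B : H →L[ℂ] H) : opTrace (A + B) = opTrace A + opTrace B := by
  simp [opTrace]

lemma opTrace_sub (A B : H →L[ℂ] H) : opTrace (A - B) = opTrace A - opTrace B := by
  simp [opTrace]

lemma opTrace_smul (c : ℂ) (A : H →L[ℂ] H) : opTrace (c • A) = c * opTrace A := by
  simp [opTrace]

variable [CompleteSpace H]

lemma opTrace_abs_rpow_two (T : H →L[ℂ] H) :
    opTrace (CFC.abs T ^ (2 : ℝ)) = opTrace (star T * T) := by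
  have := CFC.rpow_natCast (CFC.abs T) 2 (CFC.abs_nonneg T)
  rw [Nat.cast_ofNat] at this
  rw [this, CFC.abs_sq]

variable [FiniteDimensional ℂ H]

lemma re_opTrace_star (A : H →L[ℂ] H) : (opTrace (star A)).re = (opTrace A).re := by
  rw [opTrace_eq_sum (stdOrthonormalBasis ℂ H), opTrace_eq_sum (stdOrthonormalBasis ℂ H),
    Complex.re_sum, Complex.re_sum]
  refine Finset.sum_congr rfl fun i _ => ?_
  rw [ContinuousLinearMap.star_eq_adjoint, ContinuousLinearMap.adjoint_inner_right,
    ← inner_conj_symm, Complex.conj_re]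

lemma eq_zero_of_re_opTrace_star_mul_self {A : H →L[ℂ] H}
    (h : (opTrace (star A * A)).re = 0) : A = 0 := by
  set e := stdOrthonormalBasis ℂ H
  have h1 : ∀ i, (inner ℂ (e i) ((star A * A) (e i)) : ℂ).re = ‖A (e i)‖ ^ 2 := fun i =>
    (ContinuousLinearMap.apply_norm_sq_eq_inner_adjoint_right A (e i)).symm
  rw [opTrace_eq_sum e, Complex.re_sum, Finset.sum_congr rfl fun i _ => h1 i,
    Finset.sum_eq_zero_iff_of_nonneg fun i _ => sq_nonneg _] at h
  apply ContinuousLinearMap.coe_injective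
  refine e.toBasis.ext fun i => ?_
  simpa using h i (Finset.mem_univ i)

end Trace

variable {H : Type*} [NormedAddCommGroup H] [InnerProductSpace ℂ H] [CompleteSpace H]

/-- The functional `X ↦ tr (|T|^(p-1) U* X)` attached to an operator `T` with polar factor `U`. -/
noncomputable def dualPairing (p : ℝ) (T U X : H →L[ℂ] H) : ℂ :=
  opTrace (CFC.abs T ^ (p - 1) * star U * X)

lemma dualPairing_add (p : ℝ) (T U X Y : H →L[ℂ] H) :
    dualPairing p T U (X + Y) = dualPairing p T U X + dualPairing p T U Y := by
  rw [dualPairing, mul_add, opTrace_add]; rfl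

lemma dualPairing_smul (p : ℝ) (T U X : H →L[ℂ] H) (c : ℂ) :
    dualPairing p T U (c • X) = c * dualPairing p T U X := by
  rw [dualPairing, mul_smul_comm, opTrace_smul]; rfl

lemma norm_star_mul_le {U W : H →L[ℂ] H} (hU : ‖U‖ ≤ 1) (hW : ‖W‖ ≤ 1) : ‖star U * W‖ ≤ 1 :=
  (norm_mul_le _ _).trans (mul_le_one₀ (by rwa [norm_star]) (norm_nonneg _) hW)

lemma dualPairing_eq_of_isPolarFactor (p : ℝ) (T U : H →L[ℂ] H) {X W : H →L[ℂ] H}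
    (hW : IsPolarFactor X W) : dualPairing p T U X =
      opTrace (CFC.abs T ^ (p - 1) * (star U * W) * CFC.abs X) := by
  rw [dualPairing]
  nth_rewrite 1 [hW.eq_mul_abs]
  simp only [mul_assoc]

variable [FiniteDimensional ℂ H]

lemma opTrace_abs_rpow_eq {p : ℝ} (hp : p ≠ 0) (T : H →L[ℂ] H) :
    opTrace (CFC.abs T ^ p) = ((schattenNorm p T ^ p : ℝ) : ℂ) := by
  obtain ⟨e, a, ha, h⟩ := exists_eigenbasis (CFC.abs_nonneg T)
  have h0 : 0 ≤ ∑ i, a i ^ p := Finset.sum_nonneg fun i _ => Real.rpow_nonneg (ha i) _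
  rw [schattenNorm, opTrace_rpow_eq_sum e (CFC.abs_nonneg T) h, Complex.ofReal_re,
    ← Real.rpow_mul h0, one_div_mul_cancel hp, Real.rpow_one]

lemma schattenNorm_nonneg (p : ℝ) (T : H →L[ℂ] H) : 0 ≤ schattenNorm p T := by
  obtain ⟨e, a, ha, h⟩ := exists_eigenbasis (CFC.abs_nonneg T)
  rw [schattenNorm, opTrace_rpow_eq_sum e (CFC.abs_nonneg T) h, Complex.ofReal_re]
  exact Real.rpow_nonneg (Finset.sum_nonneg fun i _ => Real.rpow_nonneg (ha i) _) _

lemma schattenNorm_smul {p : ℝ} (hp : p ≠ 0) (c : ℂ) (T : H →L[ℂ] H) :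
    schattenNorm p (c • T) = ‖c‖ * schattenNorm p T := by
  obtain ⟨e, a, ha, h⟩ := exists_eigenbasis (CFC.abs_nonneg T)
  have h0 : 0 ≤ ∑ i, a i ^ p := Finset.sum_nonneg fun i _ => Real.rpow_nonneg (ha i) _
  have h' : ∀ i, CFC.abs (c • T) (e i) = ((‖c‖ * a i : ℝ) : ℂ) • e i := fun i => by
    rw [CFC.abs_smul, smul_apply, h, Complex.ofReal_mul, mul_smul]
    exact (Complex.coe_smul _ _).symm
  rw [schattenNorm, schattenNorm, opTrace_rpow_eq_sum e (CFC.abs_nonneg T) h,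
    opTrace_rpow_eq_sum e (CFC.abs_nonneg _) h', Complex.ofReal_re, Complex.ofReal_re,
    Finset.sum_congr rfl fun i _ => Real.mul_rpow (norm_nonneg c) (ha i), ← Finset.mul_sum,
    Real.mul_rpow (Real.rpow_nonneg (norm_nonneg c) _) h0, ← Real.rpow_mul (norm_nonneg c),
    mul_one_div_cancel hp, Real.rpow_one]

lemma schattenNorm_zero {p : ℝ} (hp : p ≠ 0) : schattenNorm p (0 : H →L[ℂ] H) = 0 := by
  simpa using schattenNorm_smul hp 0 (0 : H →L[ℂ] H)

lemma eq_zero_of_schattenNorm_eq_zero {p : ℝ} (hp : p ≠ 0) {T : H →L[ℂ] H}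
    (hT : schattenNorm p T = 0) : T = 0 := by
  obtain ⟨e, a, ha, h⟩ := exists_eigenbasis (CFC.abs_nonneg T)
  have h1 := opTrace_abs_rpow_eq hp T
  rw [hT, Real.zero_rpow hp, opTrace_rpow_eq_sum e (CFC.abs_nonneg T) h, Complex.ofReal_inj,
    Finset.sum_eq_zero_iff_of_nonneg fun i _ => Real.rpow_nonneg (ha i) _] at h1
  apply ContinuousLinearMap.coe_injective
  refine e.toBasis.ext fun i => ?_
  have h2 : a i = 0 := (Real.rpow_eq_zero (ha i) hp).1 (h1 i (Finset.mem_univ i))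
  have h3 : T (e i) = 0 := by rw [← norm_eq_zero, ← norm_apply_abs, h, h2]; simp
  simpa using h3

variable {p : ℝ} {T U X : H →L[ℂ] H}

lemma dualPairing_self (hp : 1 ≤ p) (hU : IsPolarFactor T U) :
    dualPairing p T U T = ((schattenNorm p T ^ p : ℝ) : ℂ) := by
  rw [dualPairing, mul_assoc, hU.star_mul_eq, rpow_sub_one_mul_self (CFC.abs_nonneg T) hp,
    opTrace_abs_rpow_eq (by linarith)]

lemma re_dualPairing_le_young (hp : 1 ≤ p) (hU : IsPolarFactor T U) (X : H →L[ℂ] H) :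
    (dualPairing p T U X).re ≤
      (1 - 1 / p) * schattenNorm p T ^ p + 1 / p * schattenNorm p X ^ p := by
  obtain ⟨W, hW⟩ := exists_isPolarFactor X
  have h := re_opTrace_rpow_sub_one_mul_mul_le hp (CFC.abs_nonneg T) (CFC.abs_nonneg X)
    (norm_star_mul_le hU.norm_le hW.norm_le)
  rw [opTrace_abs_rpow_eq (by linarith), opTrace_abs_rpow_eq (by linarith)] at h
  rw [dualPairing_eq_of_isPolarFactor p T U hW]
  exact h

/-- With equal norms the hypothesis is equality in Young's inequality, which makes the
Hilbert–Schmidt norm of X - T vanish. -/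
lemma eq_of_re_dualPairing_eq (hp : 1 < p) (hU : IsPolarFactor T U)
    (hX : schattenNorm p X = schattenNorm p T)
    (h : (dualPairing p T U X).re = schattenNorm p T ^ p) : X = T := by
  obtain ⟨W, hW⟩ := exists_isPolarFactor X
  rw [dualPairing_eq_of_isPolarFactor p T U hW] at h
  obtain ⟨h1, h2⟩ := re_opTrace_mul_mul_of_young_eq hp (CFC.abs_nonneg T) (CFC.abs_nonneg X)
    (norm_star_mul_le hU.norm_le hW.norm_le) (by
      rw [h, opTrace_abs_rpow_eq (by linarith), opTrace_abs_rpow_eq (by linarith), hX,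
        Complex.ofReal_re]
      ring)
  have h3 : CFC.abs T * (star U * W) * CFC.abs X = star T * X := by
    have h4 : star T = CFC.abs T * star U := by
      nth_rewrite 1 [hU.eq_mul_abs]
      rw [star_mul, (CFC.abs_nonneg T).isSelfAdjoint.star_eq]
    have h5 : X = W * CFC.abs X := hW.eq_mul_abs
    rw [h4]
    nth_rewrite 2 [h5]
    simp only [mul_assoc]
  rw [h3, opTrace_abs_rpow_two] at h1 h2
  have h6 : (opTrace (star X * T)).re = (opTrace (star T * X)).re := by
    rw [← re_opTrace_star, star_mul, star_star]
  refine sub_eq_zero.1 (eq_zero_of_re_opTrace_star_mul_self ?_)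
  rw [star_sub, sub_mul, mul_sub, mul_sub, opTrace_sub, opTrace_sub, opTrace_sub]
  simp only [Complex.sub_re]
  linarith

/-- Hölder's inequality for the trace pairing. -/
lemma re_dualPairing_le (hp : 1 ≤ p) (hU : IsPolarFactor T U) (hT : 0 < schattenNorm p T)
    (X : H →L[ℂ] H) :
    (dualPairing p T U X).re ≤ schattenNorm p T ^ (p - 1) * schattenNorm p X := by
  have hp0 : p ≠ 0 := by linarith
  rcases (schattenNorm_nonneg p X).eq_or_lt with h0 | h0
  · rw [← h0, eq_zero_of_schattenNorm_eq_zero hp0 h0.symm]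
    simp [dualPairing, opTrace]
  -- Rescaling X to the norm of T makes Young's bound equal to ‖T‖^p.
  set k := schattenNorm p T / schattenNorm p X with hk
  have hk0 : 0 < k := div_pos hT h0
  have h1 := re_dualPairing_le_young hp hU ((k : ℂ) • X)
  rw [schattenNorm_smul hp0, Complex.norm_of_nonneg hk0.le, hk, div_mul_cancel₀ _ h0.ne', ← hk,
    dualPairing_smul, Complex.re_ofReal_mul] at h1
  have h2 : k * (dualPairing p T U X).re ≤
      k * (schattenNorm p T ^ (p - 1) * schattenNorm p X) := by
    calc k * (dualPairing p T U X).re ≤ schattenNorm p T ^ p := by linarith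
      _ = k * (schattenNorm p T ^ (p - 1) * schattenNorm p X) := by
        rw [hk, Real.rpow_sub_one hT.ne']; field_simp
  exact le_of_mul_le_mul_left h2 hk0

/-- The equality case of Hölder's inequality for the trace pairing. -/
lemma smul_eq_of_re_dualPairing_eq (hp : 1 < p) (hU : IsPolarFactor T U)
    (hT : 0 < schattenNorm p T) (hX : 0 < schattenNorm p X)
    (h : (dualPairing p T U X).re = schattenNorm p T ^ (p - 1) * schattenNorm p X) :
    ((schattenNorm p T / schattenNorm p X : ℝ) : ℂ) • X = T := by
  refine eq_of_re_dualPairing_eq hp hU ?_ ?_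
  · rw [schattenNorm_smul (by linarith), Complex.norm_of_nonneg (by positivity),
      div_mul_cancel₀ _ hX.ne']
  · rw [dualPairing_smul, Complex.re_ofReal_mul, h, Real.rpow_sub_one hT.ne']
    field_simp

lemma exists_norm_eq_one_mul_eq_norm (z : ℂ) : ∃ c : ℂ, ‖c‖ = 1 ∧ c * z = (‖z‖ : ℂ) := by
  rcases eq_or_ne z 0 with rfl | hz
  · exact ⟨1, by simp, by simp⟩
  · have : (‖z‖ : ℂ) ≠ 0 := by simpa using hz
    exact ⟨‖z‖ / z, by simp [hz], div_mul_cancel₀ _ hz⟩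

lemma norm_dualPairing_le (hp : 1 ≤ p) (hU : IsPolarFactor T U) (hT : 0 < schattenNorm p T)
    (X : H →L[ℂ] H) :
    ‖dualPairing p T U X‖ ≤ schattenNorm p T ^ (p - 1) * schattenNorm p X := by
  obtain ⟨c, hc, hcz⟩ := exists_norm_eq_one_mul_eq_norm (dualPairing p T U X)
  have h := re_dualPairing_le hp hU hT (c • X)
  rwa [dualPairing_smul, hcz, Complex.ofReal_re, schattenNorm_smul (by linarith), hc,
    one_mul] at h

lemma schattenNorm_rpow_sub_one_mul_self (hp : 1 ≤ p) (T : H →L[ℂ] H) :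
    schattenNorm p T ^ (p - 1) * schattenNorm p T = schattenNorm p T ^ p := by
  rcases (schattenNorm_nonneg p T).eq_or_lt with h0 | h0
  · rw [← h0, mul_zero, Real.zero_rpow (by linarith)]
  · rw [Real.rpow_sub_one h0.ne', div_mul_cancel₀ _ h0.ne']

/-- Minkowski's inequality for Schatten norms. -/
lemma schattenNorm_add_le (hp : 1 ≤ p) (T S : H →L[ℂ] H) :
    schattenNorm p (T + S) ≤ schattenNorm p T + schattenNorm p S := by
  rcases (schattenNorm_nonneg p (T + S)).eq_or_lt with h0 | h0
  · rw [← h0]; exact add_nonneg (schattenNorm_nonneg p T) (schattenNorm_nonneg p S)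
  -- The sum is tested against its own norming functional.
  obtain ⟨W, hW⟩ := exists_isPolarFactor (T + S)
  have h1 := congrArg Complex.re (dualPairing_self hp hW)
  rw [dualPairing_add, Complex.add_re, Complex.ofReal_re,
    ← schattenNorm_rpow_sub_one_mul_self hp] at h1
  have h2 := re_dualPairing_le hp hW h0 T
  have h3 := re_dualPairing_le hp hW h0 S
  refine le_of_mul_le_mul_left ?_ (Real.rpow_pos_of_pos h0 (p - 1))
  linarith

lemma NormParallel.symm (hp : p ≠ 0) {T S : H →L[ℂ] H}
    (h : NormParallel (schattenNorm p) T S) : NormParallel (schattenNorm p) S T := by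
  obtain ⟨c, hc, h⟩ := h
  have hc0 : c ≠ 0 := by rintro rfl; simp at hc
  refine ⟨c⁻¹, by simp [hc], ?_⟩
  have h1 : S + c⁻¹ • T = c⁻¹ • (T + c • S) := by
    rw [smul_add, smul_smul, inv_mul_cancel₀ hc0, one_smul, add_comm]
  rw [h1, schattenNorm_smul hp, norm_inv, hc, inv_one, one_mul, h, add_comm]

/-- For p = 1 the pairing is tr(W*U|T|); attaining tr |T| with |T| invertible forces W*U = 1. -/
lemma star_eq_of_re_dualPairing_one_eq {W : H →L[ℂ] H} (hT : IsUnit T) (hU : IsPolarFactor T U)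
    {R : H →L[ℂ] H} (hW : IsPolarFactor R W)
    (h : (dualPairing 1 R W T).re = schattenNorm 1 T) : star W = star U := by
  refine hU.star_eq_of_mul_eq_one (isUnit_abs hT) ?_
  refine eq_one_of_re_opTrace_mul_eq (CFC.abs_nonneg T) (isUnit_abs hT)
    (norm_star_mul_le hW.norm_le hU.norm_le) ?_
  rw [dualPairing_eq_of_isPolarFactor 1 R W hU, sub_self, CFC.rpow_zero (CFC.abs R),
    one_mul] at h
  have h1 := congrArg Complex.re (opTrace_abs_rpow_eq one_ne_zero T)
  rw [CFC.rpow_one (CFC.abs T), Complex.ofReal_re, Real.rpow_one] at h1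
  rw [h, h1]

lemma normParallel_of_norm_dualPairing_eq (hp : 1 ≤ p) (hU : IsPolarFactor T U)
    {S : H →L[ℂ] H} (hT : 0 < schattenNorm p T)
    (h : ‖dualPairing p T U S‖ = schattenNorm p T ^ (p - 1) * schattenNorm p S) :
    NormParallel (schattenNorm p) T S := by
  obtain ⟨c, hc, hcz⟩ := exists_norm_eq_one_mul_eq_norm (dualPairing p T U S)
  refine ⟨c, hc, le_antisymm ?_ ?_⟩
  · have := schattenNorm_add_le hp T (c • S)
    rwa [schattenNorm_smul (by linarith), hc, one_mul] at this
  · have h1 := re_dualPairing_le hp hU hT (T + c • S)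
    rw [dualPairing_add, dualPairing_smul, hcz, dualPairing_self hp hU, h,
      ← schattenNorm_rpow_sub_one_mul_self hp, Complex.add_re, Complex.ofReal_re,
      Complex.ofReal_re, ← mul_add] at h1
    exact le_of_mul_le_mul_left h1 (Real.rpow_pos_of_pos hT _)

lemma norm_dualPairing_eq_of_normParallel (hp : 1 < p ∨ (p = 1 ∧ IsUnit T))
    (hU : IsPolarFactor T U) {S : H →L[ℂ] H} (hT : 0 < schattenNorm p T)
    (h : NormParallel (schattenNorm p) T S) :
    ‖dualPairing p T U S‖ = schattenNorm p T ^ (p - 1) * schattenNorm p S := by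
  have hp1 : 1 ≤ p := hp.elim le_of_lt fun h => h.1.ge
  have hp0 : p ≠ 0 := by linarith
  obtain ⟨c, hc, h⟩ := h
  have hc0 : c ≠ 0 := by rintro rfl; simp at hc
  have hS := schattenNorm_nonneg p S
  set R := T + c • S with hRdef
  have hR : 0 < schattenNorm p R := by rw [h]; linarith
  obtain ⟨W, hW⟩ := exists_isPolarFactor R
  have h1 := congrArg Complex.re (dualPairing_self hp1 hW)
  rw [Complex.ofReal_re, ← schattenNorm_rpow_sub_one_mul_self hp1] at h1
  nth_rewrite 2 [hRdef] at h1
  nth_rewrite 2 [h] at h1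
  rw [dualPairing_add, Complex.add_re] at h1
  have h2 := re_dualPairing_le hp1 hW hR T
  have h3 := re_dualPairing_le hp1 hW hR (c • S)
  rw [schattenNorm_smul hp0, hc, one_mul] at h3
  -- The bounds `h2` and `h3` add up to the equality `h1`, so both are tight.
  have h4 : (dualPairing p R W T).re = schattenNorm p R ^ (p - 1) * schattenNorm p T := by
    linarith
  have h5 : (dualPairing p R W (c • S)).re = schattenNorm p R ^ (p - 1) * schattenNorm p S := by
    linarith
  rcases hp with hp | ⟨rfl, hTu⟩
  · have h6 := smul_eq_of_re_dualPairing_eq hp hW hR hT h4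
    set k : ℂ := ((schattenNorm p R / schattenNorm p T : ℝ) : ℂ)
    have h7 : S = (c⁻¹ * (k - 1)) • T := by
      rw [mul_smul, sub_smul, one_smul, h6, hRdef, add_sub_cancel_left, smul_smul,
        inv_mul_cancel₀ hc0, one_smul]
    rw [h7, dualPairing_smul, dualPairing_self hp1 hU, schattenNorm_smul hp0, norm_mul,
      Complex.norm_of_nonneg (Real.rpow_nonneg hT.le _), ← schattenNorm_rpow_sub_one_mul_self hp1]
    ring
  · refine le_antisymm (norm_dualPairing_le le_rfl hU hT S) ?_
    rw [sub_self, Real.rpow_zero, one_mul] at h4 h5 ⊢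
    have h6 : dualPairing 1 R W (c • S) = dualPairing 1 T U (c • S) := by
      rw [dualPairing, dualPairing, star_eq_of_re_dualPairing_one_eq hTu hU hW h4, sub_self,
        CFC.rpow_zero (CFC.abs R), CFC.rpow_zero (CFC.abs T)]
    rw [h6, dualPairing_smul] at h5
    calc schattenNorm 1 S ≤ ‖c * dualPairing 1 T U S‖ := h5 ▸ Complex.re_le_norm _
      _ = ‖dualPairing 1 T U S‖ := by rw [norm_mul, hc, one_mul]

lemma normParallel_iff (hp : 1 < p ∨ (p = 1 ∧ IsUnit T)) (hU : IsPolarFactor T U)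
    (S : H →L[ℂ] H) : NormParallel (schattenNorm p) T S ↔
      ((schattenNorm p T * ‖opTrace (CFC.abs T ^ (p - 1) * star U * S)‖ : ℝ) : ℂ) =
        (schattenNorm p S : ℂ) * opTrace (CFC.abs T ^ p) := by
  have hp1 : 1 ≤ p := hp.elim le_of_lt fun h => h.1.ge
  have hp0 : p ≠ 0 := by linarith
  rw [opTrace_abs_rpow_eq hp0, ← Complex.ofReal_mul, Complex.ofReal_inj]
  change _ ↔ schattenNorm p T * ‖dualPairing p T U S‖ = _
  rcases (schattenNorm_nonneg p T).eq_or_lt with h0 | h0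
  -- For T = 0 both sides of the equivalence hold trivially.
  · have hT := eq_zero_of_schattenNorm_eq_zero hp0 h0.symm
    rw [← h0, Real.zero_rpow hp0, zero_mul, mul_zero]
    refine iff_of_true ⟨1, norm_one, ?_⟩ rfl
    rw [hT, schattenNorm_zero hp0, zero_add, zero_add, one_smul]
  · rw [← schattenNorm_rpow_sub_one_mul_self hp1]
    refine ⟨fun h => ?_, fun h => normParallel_of_norm_dualPairing_eq hp1 hU h0 ?_⟩
    · rw [norm_dualPairing_eq_of_normParallel hp hU h0 h]; ring
    · exact mul_left_cancel₀ h0.ne' (h.trans (by ring))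

end Pairing

end SchattenParallel

theorem mainTheorem4 {H : Type*} [NormedAddCommGroup H] [InnerProductSpace ℂ H]
    [FiniteDimensional ℂ H] [CompleteSpace H] (p : ℝ) (T S U V : H →L[ℂ] H)
    (hT : SchattenParallel.IsPolarDecomposition T U)
    (hS : SchattenParallel.IsPolarDecomposition S V)
    (hp : 1 < p ∨ (p = 1 ∧ IsUnit T ∧ IsUnit S)) :
    List.TFAE [
      SchattenParallel.NormParallel (SchattenParallel.schattenNorm p) T S,
      ((SchattenParallel.schattenNorm p T *
          ‖SchattenParallel.opTrace (CFC.abs T ^ (p - 1) * star U * S)‖ : ℝ) : ℂ) =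
        (SchattenParallel.schattenNorm p S : ℂ) * SchattenParallel.opTrace (CFC.abs T ^ p),
      ((SchattenParallel.schattenNorm p S *
          ‖SchattenParallel.opTrace (CFC.abs S ^ (p - 1) * star V * T)‖ : ℝ) : ℂ) =
        (SchattenParallel.schattenNorm p T : ℂ) * SchattenParallel.opTrace (CFC.abs S ^ p)] := by
  have hp0 : p ≠ 0 := by rcases hp with h | ⟨h, -⟩ <;> linarith
  have h1 := SchattenParallel.normParallel_iff (hp.imp_right fun h => ⟨h.1, h.2.1⟩)
    hT.isPolarFactor S
  have h2 := SchattenParallel.normParallel_iff (hp.imp_right fun h => ⟨h.1, h.2.2⟩)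
    hS.isPolarFactor T
  tfae_have 1 ↔ 2 := h1
  tfae_have 1 ↔ 3 := Iff.trans ⟨.symm hp0, .symm hp0⟩ h2
  tfae_finish
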